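/- Let $n\ge 2$, $1\le k\le n-1$ and $s\ge 0$ be integers, let $\mathfrak g=\mathfrak{sl}_n(\mathbb C)$ with Cartan subalgebra $\mathfrak h$ of diagonal matrices and the upper triangular Borel subalgebra, let $\omega_1,\dots,\omega_{n-1}$ be the fundamental weights (and $\omega_0=\omega_n=0$), and let $\mathcal P_+$ be the set of dominant integral weights. For a weight $\mu\in\mathfrak h^*$ let $V_\mu$ be the irreducible highest weight module of highest weight $\mu$ (the irreducible quotient of the Verma module), and let $\chi_\mu(z)$ be the scalar by which a central element $z\in U(\mathfrak g)$ acts on $V_\mu$. Put $X_{ij}=E_{ij}$ for $i\ne j$, $X_{ii}=E_{ii}-\frac1n\sum_{l}E_{ll}$, and let $$\mathfrak C_p=\sum_{i_1,\dots,i_p=1}^n X_{i_1i_2}X_{i_2i_3}\cdots X_{i_pi_1}\in Z(U(\mathfrak g)).$$ For a $k$-element subset $I\subseteq\{1,\dots,n\}$ let $\lambda_I=\sum_{i\in I}(\omega_i-\omega_{i-1})$, which is a weight of $V_{\omega_k}=\bigwedge^k\mathbb C^n$, and for $\nu\in\mathcal P_+$ with $\nu+\lambda_I\in\mathcal P_+$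 put $$f_{\mathfrak C_p,I}(\nu)=\chi_{\nu+\lambda_I}(\mathfrak C_p)-\chi_\nu(\mathfrak C_p)-\chi_{\omega_k}(\mathfrak C_p);$$ this is the eigenvalue on the constituent $V_{\nu+\lambda_I}$ of $V_{\omega_k}\otimes V_\nu$ of the operator $M_{\omega_k,\nu}(\mathfrak C_p)$, where $M_{\omega_k,\nu}(z)$ is the action of $z$ on $V_{\omega_k}\otimes V_\nu$ minus $\pi_{\omega_k}(z)\otimes\mathrm{id}$ minus $\mathrm{id}\otimes\pi_\nu(z)$, and $\pi_\mu$ denotes the action of $U(\mathfrak g)$ on $V_\mu$. Let $I\ne J$ be two distinct $k$-element subsets of $\{1,\dots,n\}$, let $r=|I\cap J|$, and let $\nu\in\mathcal P_+$ be such that $\nu+\lambda_I,\ \nu+\lambda_J\in\mathcal P_+$. If $$f_{\mathfrak C_p,I}(\nu)=f_{\mathfrak C_p,J}(\nu)\qquad\text{for all } 2\le p\le s+1,$$ then the Prouhet–Tarry–Escott problem of size $k-r$ and degree $s$ has a nontrivial solution: there are integers $x_1,\dots,x_{k-r}$ and $y_1,\dots,y_{k-r}$ such that the $x$'s are not a permutation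 of the $y$'s and $$\sum_{i=1}^{k-r}x_i^j=\sum_{i=1}^{k-r}y_i^j\qquad (j=1,\dots,s).$$ -/

import Mathlib

open scoped TensorProduct

attribute [local instance 100] LieRing.ofAssociativeRing

noncomputable section

namespace SLn

/-- The Lie algebra `sl_n(ℂ)` of traceless `n × n` matrices. -/
abbrev sl (n : ℕ) : LieSubalgebra ℂ (Matrix (Fin n) (Fin n) ℂ) :=
  LieAlgebra.SpecialLinear.sl (Fin n) ℂ

/-- The universal enveloping algebra `U(sl_n(ℂ))`. -/
abbrev U (n : ℕ) : Type := UniversalEnvelopingAlgebra ℂ (sl n)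

/-- The inclusion `sl_n(ℂ) → U(sl_n(ℂ))`. -/
abbrev ι (n : ℕ) : sl n →ₗ⁅ℂ⁆ U n := UniversalEnvelopingAlgebra.ι ℂ

/-- `X_{ij} = E_{ij}` for `i ≠ j`, and `X_{ii} = E_{ii} - (1/n) ∑ₖ E_{kk}`. -/
def X {n : ℕ} (i j : Fin n) : sl n :=
  ⟨Matrix.single i j 1 - (if i = j then (1 / (n : ℂ)) else 0) • (1 : Matrix (Fin n) (Fin n) ℂ), by
    have hn : (n : ℂ) ≠ 0 := by
      have := i.pos
      exact_mod_cast this.ne'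
    refine LinearMap.mem_ker.2 ?_
    rw [Matrix.traceLinearMap_apply]
    rw [Matrix.trace_sub, Matrix.trace_smul, Matrix.trace_one, Fintype.card_fin]
    by_cases h : i = j
    · subst h
      simp [hn]
    · simp [h, Matrix.trace_single_eq_of_ne]⟩

/-- The matrix over `U(sl_n(ℂ))` whose `(i, j)` entry is `X_{ij}`. -/
def XMat (n : ℕ) : Matrix (Fin n) (Fin n) (U n) :=
  Matrix.of fun i j => ι n (X i j)

/-- The Casimir element `C_p = ∑_{i₁,…,i_p} X_{i₁ i₂} X_{i₂ i₃} ⋯ X_{i_p i₁}`, that is, the trace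
of the `p`-th power (with ordered products) of the matrix `(X_{ij})` over `U(sl_n(ℂ))`. -/
def casimir (n p : ℕ) : U n := Matrix.trace (XMat n ^ p)

/-- The Cartan subalgebra `𝔥` of diagonal matrices in `sl_n(ℂ)`. -/
def cartan (n : ℕ) : Submodule ℂ (sl n) where
  carrier := {x | ∀ i j : Fin n, i ≠ j → x.1 i j = 0}
  add_mem' := fun {x y} hx hy i j h => by
    change x.1 i j + y.1 i j = 0
    rw [hx i j h, hy i j h, add_zero]
  zero_mem' := fun _ _ _ => rfl
  smul_mem' := fun c x hx i j h => by
    change c • x.1 i j = 0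
    rw [hx i j h, smul_zero]

/-- The weights: linear functionals on the Cartan subalgebra. -/
abbrev Weight (n : ℕ) : Type := Module.Dual ℂ (cartan n)

lemma X_self_mem {n : ℕ} (i : Fin n) : X i i ∈ cartan n := by
  intro a b hab
  simp only [X, Matrix.sub_apply, Matrix.smul_apply, Matrix.one_apply_ne hab, smul_zero, sub_zero]
  rw [Matrix.single_apply, if_neg]
  rintro ⟨rfl, rfl⟩
  exact hab rfl

/-- `X_{ii}` as an element of the Cartan subalgebra. -/
def Xdiag {n : ℕ} (i : Fin n) : cartan n := ⟨X i i, X_self_mem i⟩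

/-- The coroot `h_i = X_{ii} - X_{i+1,i+1}` of a simple root (indices start at `0`). -/
def simpleCoroot {n : ℕ} (i : ℕ) (hi : i + 1 < n) : cartan n :=
  Xdiag ⟨i, Nat.lt_of_succ_lt hi⟩ - Xdiag ⟨i + 1, hi⟩

/-- The set `𝒫₊` of dominant integral weights. -/
def IsDominantIntegral {n : ℕ} (μ : Weight n) : Prop :=
  ∀ (i : ℕ) (hi : i + 1 < n), ∃ a : ℕ, μ (simpleCoroot i hi) = a

/-- The fundamental weight `ω_m`, which sends `diag(x₁, …, x_n)` to `x₁ + ⋯ + x_m`.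
In particular `ω_0 = ω_n = 0`. -/
def fundamentalWeight (n m : ℕ) : Weight n where
  toFun x := ∑ i : Fin n, if i.val < m then x.1.1 i i else 0
  map_add' x y := by
    rw [← Finset.sum_add_distrib]
    refine Finset.sum_congr rfl fun i _ => ?_
    split_ifs
    · rfl
    · simp
  map_smul' c x := by
    rw [RingHom.id_apply, Finset.smul_sum]
    refine Finset.sum_congr rfl fun i _ => ?_
    split_ifs
    · rfl
    · simp

lemma fundamentalWeight_simpleCoroot {n : ℕ} (m i : ℕ) (hi : i + 1 < n) :
    fundamentalWeight n m (simpleCoroot i hi) = if m = i + 1 then 1 else 0 := by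
  have h : ∀ a : Fin n, (simpleCoroot i hi).1.1 a a
      = (if a = ⟨i, Nat.lt_of_succ_lt hi⟩ then 1 else 0) - (if a = ⟨i + 1, hi⟩ then 1 else 0) := by
    intro a
    change (X _ _).1 a a - (X _ _).1 a a = _
    simp only [X, Matrix.sub_apply, Matrix.single_apply, and_self, if_true, sub_sub_sub_cancel_right,
      eq_comm (b := a)]
  change (∑ a : Fin n, if a.val < m then (simpleCoroot i hi).1.1 a a else 0) = _
  simp only [h]
  have h2 : ∀ a : Fin n, (if a.val < m then
      ((if a = ⟨i, Nat.lt_of_succ_lt hi⟩ then (1 : ℂ) else 0) - (if a = ⟨i + 1, hi⟩ then 1 else 0))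
      else 0) = (if a = ⟨i, Nat.lt_of_succ_lt hi⟩ then (if i < m then 1 else 0) else 0)
        - (if a = ⟨i + 1, hi⟩ then (if i + 1 < m then 1 else 0) else 0) := by
    intro a
    by_cases h1 : a = ⟨i, Nat.lt_of_succ_lt hi⟩
    · subst h1; simp
    · by_cases h2 : a = ⟨i + 1, hi⟩
      · subst h2; split_ifs <;> simp_all
      · simp [h1, h2]
  rw [Finset.sum_congr rfl fun a _ => h2 a, Finset.sum_sub_distrib, Finset.sum_ite_eq',
    Finset.sum_ite_eq', if_pos (Finset.mem_univ _), if_pos (Finset.mem_univ _)]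
  by_cases h3 : m = i + 1
  · simp [h3]
  · by_cases h4 : i + 1 < m
    · simp [h3, h4, Nat.lt_of_succ_lt h4]
    · simp [h3, h4, show ¬ i < m by omega]

/-- The weight `λ_I = ∑_{i ∈ I} (ω_i - ω_{i-1})` of `e_{i₁} ∧ ⋯ ∧ e_{i_k}` in `V_{ω_k} = ⋀ᵏ ℂⁿ`,
for `I = {i₁ < ⋯ < i_k}`; the element `i : Fin n` stands for the index `i + 1` in `{1, …, n}`. -/
def subsetWeight {n : ℕ} (I : Finset (Fin n)) : Weight n :=
  ∑ i ∈ I, (fundamentalWeight n (i.val + 1) - fundamentalWeight n i.val)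

/-- The left ideal of `U(sl_n(ℂ))` generated by the strictly upper triangular matrices `𝔫` and by
`h - μ(h)` for `h` in the Cartan subalgebra. -/
def vermaIdeal {n : ℕ} (μ : Weight n) : Submodule (U n) (U n) :=
  Submodule.span (U n)
    ({u | ∃ i j : Fin n, i < j ∧ u = ι n (X i j)} ∪
      {u | ∃ h : cartan n, u = ι n h.1 - algebraMap ℂ (U n) (μ h)})

/-- The Verma module with highest weight `μ`. -/
abbrev Verma {n : ℕ} (μ : Weight n) : Type := U n ⧸ vermaIdeal μ

/-- The irreducible module `V_μ` with highest weight `μ`: the quotient of the Verma module by the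
sum of all its proper submodules. -/
abbrev V {n : ℕ} (μ : Weight n) : Type :=
  Verma μ ⧸ (sSup {N : Submodule (U n) (Verma μ) | N ≠ ⊤})

/-- The infinitesimal central character `χ_μ`: the scalar by which `u` acts on `V_μ`. (The value
`0` is given to those `u` that do not act by a scalar; central elements do.) -/
def chi {n : ℕ} (μ : Weight n) (u : U n) : ℂ :=
  open Classical in
  if h : ∃ c : ℂ, ∀ v : V μ, u • v = c • v then h.choose else 0

lemma X_bracket {n : ℕ} (i j k m : Fin n) :
    ⁅X i j, X k m⁆ = (if j = k then X i m else 0) - (if m = i then X k j else 0) := by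
  apply Subtype.ext
  rw [LieAlgebra.SpecialLinear.sl_bracket]
  have h1 : ((if j = k then X i m else 0 : sl n) : Matrix (Fin n) (Fin n) ℂ)
      = if j = k then (X i m).1 else 0 := by split_ifs <;> rfl
  have h2 : ((if m = i then X k j else 0 : sl n) : Matrix (Fin n) (Fin n) ℂ)
      = if m = i then (X k j).1 else 0 := by split_ifs <;> rfl
  rw [AddSubgroupClass.coe_sub, h1, h2]
  simp only [X, sub_mul, mul_sub, smul_mul_assoc, mul_smul_comm, one_mul, mul_one]
  by_cases hjk : j = k
  · subst hjk
    by_cases hmi : m = i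
    · subst hmi
      simp only [Matrix.single_mul_single_same, if_true, mul_one]
      module
    · rw [Matrix.single_mul_single_of_ne (h := hmi)]
      simp only [Matrix.single_mul_single_same, if_true, if_neg hmi, if_neg (Ne.symm hmi), one_mul]
      module
  · by_cases hmi : m = i
    · subst hmi
      rw [Matrix.single_mul_single_of_ne (h := hjk)]
      simp only [Matrix.single_mul_single_same, if_true, if_neg hjk, if_neg (Ne.symm hjk), one_mul]
      module
    · rw [Matrix.single_mul_single_of_ne (h := hjk), Matrix.single_mul_single_of_ne (h := hmi)]
      simp only [if_neg hjk, if_neg hmi]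
      module

lemma X_commutator {n : ℕ} (i j k m : Fin n) :
    ι n (X i j) * ι n (X k m) - ι n (X k m) * ι n (X i j)
      = (if j = k then ι n (X i m) else 0) - (if m = i then ι n (X k j) else 0) := by
  rw [← LieRing.of_associative_ring_bracket, ← LieHom.map_lie, X_bracket, map_sub]
  split_ifs <;> simp

lemma XMat_pow_commutator {n : ℕ} (p : ℕ) (k m i j : Fin n) :
    ι n (X k m) * (XMat n ^ p) i j - (XMat n ^ p) i j * ι n (X k m)
      = (if m = i then (XMat n ^ p) k j else 0) - (if j = k then (XMat n ^ p) i m else 0) := by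
  induction p generalizing i j with
  | zero =>
    simp only [pow_zero, Matrix.one_apply]
    have h : (if m = i then (if k = j then (1 : U n) else 0) else 0)
        = if j = k then (if i = m then 1 else 0) else 0 := by
      simp only [eq_comm (a := k) (b := j), eq_comm (a := i) (b := m)]
      split_ifs <;> rfl
    rw [h, sub_self]
    split_ifs
    · rw [mul_one, one_mul, sub_self]
    · rw [mul_zero, zero_mul, sub_self]
  | succ p ih =>
    have e : ∀ a b : Fin n, (XMat n ^ (p + 1)) a b = ∑ l, (XMat n ^ p) a l * ι n (X l b) := by
      intro a b
      rw [pow_succ, Matrix.mul_apply]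
      rfl
    have key : ∀ l : Fin n, ι n (X k m) * ((XMat n ^ p) i l * ι n (X l j))
        - (XMat n ^ p) i l * ι n (X l j) * ι n (X k m)
        = ((if m = i then (XMat n ^ p) k l else 0) - (if l = k then (XMat n ^ p) i m else 0))
            * ι n (X l j)
          + (XMat n ^ p) i l *
            ((if m = l then ι n (X k j) else 0) - (if j = k then ι n (X l m) else 0)) := by
      intro l
      rw [← ih, ← X_commutator]
      noncomm_ring
    rw [e, e, e, Finset.mul_sum, Finset.sum_mul, ← Finset.sum_sub_distrib,
      Finset.sum_congr rfl fun l _ => key l]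
    simp only [sub_mul, mul_sub, ite_mul, mul_ite, zero_mul, mul_zero, Finset.sum_add_distrib,
      Finset.sum_sub_distrib, Finset.sum_ite_eq, Finset.sum_ite_eq', Finset.mem_univ, if_true]
    split_ifs
    · abel
    · simp only [Finset.sum_const_zero]
      abel
    · simp only [Finset.sum_const_zero]
      abel
    · simp only [Finset.sum_const_zero]
      abel

lemma sl_eq_sum {n : ℕ} (x : sl n) : x = ∑ i, ∑ j, x.1 i j • X i j := by
  apply Subtype.ext
  have hc : ((∑ i, ∑ j, x.1 i j • X i j : sl n) : Matrix (Fin n) (Fin n) ℂ)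
      = ∑ i, ∑ j, x.1 i j • (X i j).1 := by
    rw [AddSubmonoidClass.coe_finsetSum]
    refine Finset.sum_congr rfl fun i _ => ?_
    rw [AddSubmonoidClass.coe_finsetSum]
    rfl
  have ht : ∑ i, x.1 i i = 0 := LinearMap.mem_ker.1 x.2
  rw [hc]
  have hi : ∀ i : Fin n, ∑ j, x.1 i j • (X i j).1
      = ∑ j, Matrix.single i j (x.1 i j) - x.1 i i • (1 / (n : ℂ)) • 1 := by
    intro i
    simp only [X, smul_sub, Finset.sum_sub_distrib]
    congr 1
    · exact Finset.sum_congr rfl fun j _ => by rw [Matrix.smul_single, smul_eq_mul, mul_one]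
    · rw [Finset.sum_eq_single i]
      · rw [if_pos rfl]
      · intro b _ hb
        rw [if_neg (Ne.symm hb), zero_smul, smul_zero]
      · exact fun h => absurd (Finset.mem_univ i) h
  rw [Finset.sum_congr rfl fun i _ => hi i, Finset.sum_sub_distrib, ← Finset.sum_smul, ht,
    zero_smul, sub_zero]
  exact Matrix.matrix_eq_sum_single x.1

lemma mem_of_generators {n : ℕ} (S : Subalgebra ℂ (U n)) (hS : ∀ x : sl n, ι n x ∈ S) (u : U n) :
    u ∈ S := by
  let g : sl n →ₗ⁅ℂ⁆ S :=
    { toFun := fun x => ⟨ι n x, hS x⟩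
      map_add' := fun x y => Subtype.ext (map_add _ _ _)
      map_smul' := fun c x => Subtype.ext (map_smul _ _ _)
      map_lie' := fun {x y} => Subtype.ext (LieHom.map_lie _ _ _) }
  have hid : S.val.comp (UniversalEnvelopingAlgebra.lift ℂ g) = AlgHom.id ℂ (U n) := by
    apply UniversalEnvelopingAlgebra.hom_ext
    ext x
    simp [g]
  have := congrArg (fun φ : U n →ₐ[ℂ] U n => φ u) hid
  simp only [AlgHom.comp_apply, AlgHom.id_apply] at this
  rw [← this]
  exact Subtype.coe_prop _

lemma casimir_commute {n : ℕ} (p : ℕ) (u : U n) : u * casimir n p = casimir n p * u := by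
  have hX : ∀ k m : Fin n, ι n (X k m) * casimir n p = casimir n p * ι n (X k m) := by
    intro k m
    rw [← sub_eq_zero, casimir, Matrix.trace, Finset.mul_sum, Finset.sum_mul,
      ← Finset.sum_sub_distrib]
    simp only [Matrix.diag_apply, XMat_pow_commutator, Finset.sum_sub_distrib, Finset.sum_ite_eq,
      Finset.sum_ite_eq', Finset.mem_univ, if_true, sub_self]
  have hL : ∀ x : sl n, ι n x ∈ Subalgebra.centralizer ℂ {casimir n p} := by
    intro x
    rw [sl_eq_sum x]
    simp only [map_sum, map_smul]
    refine Subalgebra.sum_mem _ fun i _ => Subalgebra.sum_mem _ fun j _ =>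
      Subalgebra.smul_mem _ ?_ _
    rw [Subalgebra.mem_centralizer_iff]
    rintro g rfl
    exact (hX i j).symm
  have hu := mem_of_generators _ hL u
  exact ((Subalgebra.mem_centralizer_iff ℂ).1 hu _ rfl).symm

/-- The highest weight vector of `V_μ`. -/
def hwVector {n : ℕ} (μ : Weight n) : V μ :=
  Submodule.Quotient.mk (Submodule.Quotient.mk 1)

lemma hwVector_generates {n : ℕ} (μ : Weight n) (v : V μ) : ∃ u : U n, v = u • hwVector μ := by
  obtain ⟨w, rfl⟩ := Submodule.Quotient.mk_surjective _ v
  obtain ⟨u, rfl⟩ := Submodule.Quotient.mk_surjective _ w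
  refine ⟨u, ?_⟩
  rw [hwVector, ← Submodule.Quotient.mk_smul, ← Submodule.Quotient.mk_smul, smul_eq_mul, mul_one]

lemma smul_hwVector_of_mem {n : ℕ} (μ : Weight n) {u : U n} (hu : u ∈ vermaIdeal μ) :
    u • hwVector μ = 0 := by
  rw [hwVector, ← Submodule.Quotient.mk_smul, ← Submodule.Quotient.mk_smul, smul_eq_mul, mul_one,
    (Submodule.Quotient.mk_eq_zero _).2 hu, Submodule.Quotient.mk_zero]

lemma raising_hwVector {n : ℕ} (μ : Weight n) {i j : Fin n} (h : i < j) :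
    ι n (X i j) • hwVector μ = 0 :=
  smul_hwVector_of_mem μ (Submodule.subset_span (Or.inl ⟨i, j, h, rfl⟩))

lemma cartan_hwVector {n : ℕ} (μ : Weight n) (h : cartan n) :
    ι n h.1 • hwVector μ = μ h • hwVector μ := by
  have := smul_hwVector_of_mem μ (u := ι n h.1 - algebraMap ℂ (U n) (μ h))
    (Submodule.subset_span (Or.inr ⟨h, rfl⟩))
  rw [sub_smul, sub_eq_zero, algebraMap_smul] at this
  exact this

lemma smul_comm_V {n : ℕ} (μ : Weight n) (u : U n) (c : ℂ) (v : V μ) :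
    u • c • v = c • u • v := by
  rw [← algebraMap_smul (U n) c v, ← algebraMap_smul (U n) c (u • v), ← mul_smul, ← mul_smul,
    Algebra.commutes]

lemma XMat_pow_hwVector {n : ℕ} (μ : Weight n) (p : ℕ) (i j : Fin n) (hij : i ≤ j) :
    ∃ c : ℂ, (i < j → c = 0) ∧ (XMat n ^ p) i j • hwVector μ = c • hwVector μ := by
  induction p generalizing i j with
  | zero =>
    rcases hij.eq_or_lt with rfl | h
    · exact ⟨1, fun h => absurd h (lt_irrefl _), by simp⟩
    · exact ⟨0, fun _ => rfl, by simp [Matrix.one_apply_ne h.ne]⟩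
  | succ p ih =>
    have term : ∀ l : Fin n, ∃ c : ℂ, (i < j → c = 0) ∧
        ((XMat n ^ p) i l * ι n (X l j)) • hwVector μ = c • hwVector μ := by
      intro l
      rcases lt_trichotomy l j with h | rfl | h
      · exact ⟨0, fun _ => rfl, by rw [mul_smul, raising_hwVector μ h, smul_zero, zero_smul]⟩
      · obtain ⟨c, hc, e⟩ := ih i l hij
        refine ⟨μ (Xdiag l) * c, fun h => by rw [hc h, mul_zero], ?_⟩
        have := cartan_hwVector μ (Xdiag l)
        change ι n (X l l) • hwVector μ = _ at this
        rw [mul_smul, this, smul_comm_V, e, smul_smul]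
      · obtain ⟨c, hc, e⟩ := ih i l (hij.trans h.le)
        obtain ⟨a, ha, ea⟩ := ih i j hij
        obtain ⟨b, hb, eb⟩ := ih l l le_rfl
        have comm := XMat_pow_commutator p l j i l
        rw [if_pos rfl, sub_eq_iff_eq_add, ← sub_eq_iff_eq_add'] at comm
        refine ⟨a - (if j = i then b else 0), fun h' => by
          rw [ha h', if_neg h'.ne', sub_zero], ?_⟩
        rw [← comm, sub_smul, sub_smul, mul_smul, e, hc (hij.trans_lt h), zero_smul, smul_zero,
          ea]
        split_ifs
        · rw [eb, zero_sub, neg_sub, ← sub_smul]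
        · rw [zero_smul, zero_sub, zero_sub, neg_neg, sub_zero]
    choose c hc e using term
    refine ⟨∑ l, c l, fun h => Finset.sum_eq_zero fun l _ => hc l h, ?_⟩
    rw [pow_succ, Matrix.mul_apply, Finset.sum_smul, Finset.sum_smul]
    exact Finset.sum_congr rfl fun l _ => e l

/-- The Casimir elements act by scalars on `V_μ`. -/
lemma casimir_smul {n : ℕ} (μ : Weight n) (p : ℕ) (v : V μ) :
    casimir n p • v = chi μ (casimir n p) • v := by
  have h : ∃ c : ℂ, ∀ v : V μ, casimir n p • v = c • v := by
    choose c _ e using fun i : Fin n => XMat_pow_hwVector μ p i i le_rfl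
    refine ⟨∑ i, c i, fun v => ?_⟩
    obtain ⟨u, rfl⟩ := hwVector_generates μ v
    rw [← mul_smul, ← casimir_commute, mul_smul, ← smul_comm_V]
    congr 1
    rw [casimir, Matrix.trace, Finset.sum_smul, Finset.sum_smul]
    exact Finset.sum_congr rfl fun i _ => e i
  rw [chi, dif_pos h]
  exact h.choose_spec v

/-- The eigenvalue of `M_{ω_k,ν}(C_p)` on the constituent `V_{ν + λ_I}` of `V_{ω_k} ⊗ V_ν`:
`f_{C_p, I}(ν) = χ_{ν + λ_I}(C_p) - χ_ν(C_p) - χ_{ω_k}(C_p)`. -/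
def f {n : ℕ} (k p : ℕ) (I : Finset (Fin n)) (ν : Weight n) : ℂ :=
  chi (ν + subsetWeight I) (casimir n p) - chi ν (casimir n p)
    - chi (fundamentalWeight n k) (casimir n p)

/-- The Lie module structure of `V_μ`. -/
instance instLieRingModuleV {n : ℕ} (μ : Weight n) : LieRingModule (sl n) (V μ) where
  bracket x v := ι n x • v
  add_lie x y v := by
    change ι n (x + y) • v = ι n x • v + ι n y • v
    rw [map_add, add_smul]
  lie_add x v w := smul_add _ _ _
  leibniz_lie x y v := by
    change ι n x • ι n y • v = ι n ⁅x, y⁆ • v + ι n y • ι n x • v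
    rw [LieHom.map_lie, LieRing.of_associative_ring_bracket, sub_smul, mul_smul, mul_smul,
      sub_add_cancel]

instance instLieModuleV {n : ℕ} (μ : Weight n) : LieModule ℂ (sl n) (V μ) where
  smul_lie c x v := by
    change ι n (c • x) • v = c • (ι n x • v)
    rw [map_smul, smul_assoc]
  lie_smul c x v := by
    change ι n x • (c • v) = c • (ι n x • v)
    rw [← algebraMap_smul (U n) c v, ← algebraMap_smul (U n) c (ι n x • v), ← mul_smul,
      ← mul_smul, Algebra.commutes]

/-- The action of `U(sl_n(ℂ))` on a Lie module. -/
def act (n : ℕ) (W : Type) [AddCommGroup W] [Module ℂ W] [LieRingModule (sl n) W]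
    [LieModule ℂ (sl n) W] : U n →ₐ[ℂ] Module.End ℂ W :=
  UniversalEnvelopingAlgebra.lift ℂ (LieModule.toEnd ℂ (sl n) W)

/-- Kostant's operator `M_{μ,ν}(z) = δ_{μ,ν}(z) - π_μ(z) ⊗ id - id ⊗ π_ν(z)` on `V_μ ⊗ V_ν`. -/
def M {n : ℕ} (μ ν : Weight n) (z : U n) : Module.End ℂ (V μ ⊗[ℂ] V ν) :=
  act n (V μ ⊗[ℂ] V ν) z - TensorProduct.map (act n (V μ) z) LinearMap.id
    - TensorProduct.map LinearMap.id (act n (V ν) z)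

lemma act_V {n : ℕ} (μ : Weight n) (u : U n) (v : V μ) : act n (V μ) u v = u • v := by
  let S : Subalgebra ℂ (U n) :=
    { carrier := {u | ∀ w : V μ, act n (V μ) u w = u • w}
      mul_mem' := fun {a b} ha hb w => by
        rw [map_mul, Module.End.mul_apply, ha, hb, mul_smul]
      add_mem' := fun {a b} ha hb w => by
        rw [map_add, LinearMap.add_apply, ha, hb, add_smul]
      algebraMap_mem' := fun c w => by
        rw [AlgHom.commutes, Module.algebraMap_end_apply, algebraMap_smul] }
  refine mem_of_generators S (fun x w => ?_) u v
  rw [act, UniversalEnvelopingAlgebra.lift_ι_apply]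
  rfl

lemma act_map {n : ℕ} {W₁ W₂ : Type} [AddCommGroup W₁] [Module ℂ W₁] [LieRingModule (sl n) W₁]
    [LieModule ℂ (sl n) W₁] [AddCommGroup W₂] [Module ℂ W₂] [LieRingModule (sl n) W₂]
    [LieModule ℂ (sl n) W₂] (φ : W₁ →ₗ⁅ℂ, sl n⁆ W₂) (u : U n) (w : W₁) :
    φ (act n W₁ u w) = act n W₂ u (φ w) := by
  let S : Subalgebra ℂ (U n) :=
    { carrier := {u | ∀ w, φ (act n W₁ u w) = act n W₂ u (φ w)}
      mul_mem' := fun {a b} ha hb w => by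
        simp only [map_mul, Module.End.mul_apply] at *
        rw [ha, hb]
      add_mem' := fun {a b} ha hb w => by
        simp only [map_add, LinearMap.add_apply] at *
        rw [ha, hb]
      algebraMap_mem' := fun c w => by
        simp only [AlgHom.commutes, Module.algebraMap_end_apply, map_smul] }
  refine mem_of_generators S (fun x w => ?_) u w
  rw [act, act, UniversalEnvelopingAlgebra.lift_ι_apply, UniversalEnvelopingAlgebra.lift_ι_apply]
  exact φ.map_lie x w

lemma act_tensor {n : ℕ} {A B C : Type} [AddCommGroup A] [Module ℂ A] [LieRingModule (sl n) A]
    [LieModule ℂ (sl n) A] [AddCommGroup B] [Module ℂ B] [LieRingModule (sl n) B]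
    [LieModule ℂ (sl n) B] [AddCommGroup C] [Module ℂ C] [LieRingModule (sl n) C]
    [LieModule ℂ (sl n) C] (φ : C →ₗ⁅ℂ, sl n⁆ (A ⊗[ℂ] B)) (z : U n) (a b c : ℂ)
    (ha : ∀ v, act n A z v = a • v) (hb : ∀ v, act n B z v = b • v)
    (hc : ∀ v, act n C z v = c • v) (v : C) :
    (act n (A ⊗[ℂ] B) z - TensorProduct.map (act n A z) LinearMap.id
      - TensorProduct.map LinearMap.id (act n B z) : Module.End ℂ (A ⊗[ℂ] B)) (φ v) = (c - b - a) • φ v := by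
  have ha' : act n A z = a • LinearMap.id := LinearMap.ext ha
  have hb' : act n B z = b • LinearMap.id := LinearMap.ext hb
  rw [ha', hb', TensorProduct.map_smul_left, TensorProduct.map_smul_right, TensorProduct.map_id,
    LinearMap.sub_apply, LinearMap.sub_apply, ← act_map, hc, LinearMap.smul_apply,
    LinearMap.smul_apply, LinearMap.id_apply, map_smul, ← sub_smul, ← sub_smul, sub_right_comm]

/-- `M_{ω_k,ν}(C_p)` acts on each copy of `V_{ν + λ_I}` in `V_{ω_k} ⊗ V_ν` by the scalar
`f_{C_p, I}(ν)`. -/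
lemma M_constituent {n : ℕ} (k p : ℕ) (I : Finset (Fin n)) (ν : Weight n)
    (φ : V (ν + subsetWeight I) →ₗ⁅ℂ, sl n⁆ (V (fundamentalWeight n k) ⊗[ℂ] V ν))
    (v : V (ν + subsetWeight I)) :
    M (fundamentalWeight n k) ν (casimir n p) (φ v) = f k p I ν • φ v :=
  act_tensor φ (casimir n p) _ _ _ (fun v => (act_V _ _ v).trans (casimir_smul _ _ v))
    (fun v => (act_V _ _ v).trans (casimir_smul _ _ v))
    (fun v => (act_V _ _ v).trans (casimir_smul _ _ v)) v

end SLn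

/-- The Prouhet–Tarry–Escott problem of the given size and degree has a nontrivial solution: there
are two lists of integers, not permutations of each other, with equal power sums of the exponents
`1, …, degree`. -/
def HasNontrivialPTESolution (size degree : ℕ) : Prop :=
  ∃ x y : Fin size → ℤ, (¬ ∃ σ : Equiv.Perm (Fin size), y = x ∘ σ) ∧
    ∀ j : ℕ, 1 ≤ j → j ≤ degree → ∑ i, x i ^ j = ∑ i, y i ^ j

end

/-! Encode a dominant weight μ by its shifted coordinates m_i = μ(X_ii) + (n - i), 1 ≤ i ≤ n. Let
the diagonal entries of powers of the matrix (X_ij) act on the highest weight vector: commuting the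
X_ij gives a triangular recursion for the eigenvalues, whose solution is 1 - X ∑_p χ_μ(C_p) X^p =
∏_i (1 - (m_i + 1) X) / (1 - m_i X) (`chi_casimir_generatingFunction`). By logarithmic derivatives,
the χ_μ(C_p) with p ≤ N determine the sums of (m_i + 1)^(j+1) - m_i^(j+1), and from these the power
sums of the m_i, for j ≤ N (`sum_pow_eq_of_chi_casimir_eq`).

Adding λ_I to ν raises the coordinates indexed by I by 1, after a translation by -k/n that is the
same for I and J. Equal power sums up to degree s + 1 therefore give equal forward differences over
I and J, hence equal power sums of the unraised coordinates over I and J up to degree s. Since ν is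
dominant integral, these coordinates are distinct and become integers after a common translation;
discarding I ∩ J leaves a nontrivial solution.

The eigenvalues can be read off only if V_μ ≠ 0 (`hwVector_ne_zero`). The Verma module is nonzero
because a product of principal minors is a nonzero highest weight vector of weight μ in a polynomial
representation; a grading then shows that the sum of the proper submodules misses the generator. -/

noncomputable section

/-! ### Power sums from forward differences -/

section PowerSums

open Finset

variable {α β R : Type*} [CommRing R]

/-- Binomial expansion with the term m = j split off. Its coefficient j + 1 is nonzero in
characteristic zero, so the system is triangular and can be solved for the power sums. -/
lemma sum_forward_difference_eq (S : Finset α) (c : α → R) (j : ℕ) :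
    ∑ i ∈ S, ((c i + 1) ^ (j + 1) - c i ^ (j + 1))
      = ∑ m ∈ range j, (∑ i ∈ S, c i ^ m) * ((j + 1).choose m : R)
        + (∑ i ∈ S, c i ^ j) * ((j : R) + 1) := by
  have : ∀ i, (c i + 1) ^ (j + 1) - c i ^ (j + 1)
      = ∑ m ∈ range j, c i ^ m * ((j + 1).choose m : R) + c i ^ j * ((j : R) + 1) := by
    intro i
    rw [add_pow, sum_range_succ, sum_range_succ]
    simp
  rw [sum_congr rfl fun i _ => this i, sum_add_distrib, sum_comm, sum_mul]
  simp only [sum_mul]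

/-- If the sums of `(t + 1) ^ (j + 1) - t ^ (j + 1)` over two families agree for `j ≤ N`, then so do
their power sums of exponents `j ≤ N`. -/
lemma sum_pow_eq_of_sum_forward_difference_eq [IsDomain R] [CharZero R] (A : Finset α)
    (B : Finset β) (a : α → R) (b : β → R) (N : ℕ)
    (h : ∀ j ≤ N, ∑ i ∈ A, ((a i + 1) ^ (j + 1) - a i ^ (j + 1))
      = ∑ i ∈ B, ((b i + 1) ^ (j + 1) - b i ^ (j + 1))) :
    ∀ j ≤ N, ∑ i ∈ A, a i ^ j = ∑ i ∈ B, b i ^ j := by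
  intro j
  induction j using Nat.strong_induction_on with
  | _ j ih =>
    intro hj
    have e := h j hj
    rw [sum_forward_difference_eq, sum_forward_difference_eq, sum_congr rfl fun m hm => by
      rw [ih m (mem_range.1 hm) ((mem_range.1 hm).le.trans hj)]] at e
    exact mul_right_cancel₀ (Nat.cast_add_one_ne_zero j) (add_left_cancel e)

/-- Equality of power sums up to a given exponent is invariant under translation. -/
lemma sum_add_pow_eq_of_sum_pow_eq (A : Finset α) (B : Finset β) (a : α → R) (b : β → R)
    (c : R) (N : ℕ) (h : ∀ j ≤ N, ∑ i ∈ A, a i ^ j = ∑ i ∈ B, b i ^ j) :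
    ∀ j ≤ N, ∑ i ∈ A, (a i + c) ^ j = ∑ i ∈ B, (b i + c) ^ j := by
  intro j hj
  simp only [add_pow]
  rw [sum_comm, sum_comm (s := B)]
  refine sum_congr rfl fun m hm => ?_
  simp only [← sum_mul]
  rw [h m ((Nat.lt_succ_iff.1 (mem_range.1 hm)).trans hj)]

end PowerSums

/-! ### Logarithmic derivatives and the generating function -/

section GeneratingFunction

open PowerSeries Finset

variable {K : Type*} [Field K]

/-- A product of elements with logarithmic derivatives `s i` has logarithmic derivative `∑ s i`. -/
lemma Derivation.prod_of_eq_mul {R A ι : Type*} [CommRing R] [CommRing A] [Algebra R A]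
    (D : Derivation R A A) (S : Finset ι) (r s : ι → A) (h : ∀ i ∈ S, D (r i) = r i * s i) :
    D (∏ i ∈ S, r i) = (∏ i ∈ S, r i) * ∑ i ∈ S, s i := by
  classical
  induction S using Finset.induction_on with
  | empty => simp
  | insert a S ha ih =>
    rw [prod_insert ha, sum_insert ha, Derivation.leibniz, h a (mem_insert_self _ _),
      ih fun i hi => h i (mem_insert_of_mem hi), smul_eq_mul, smul_eq_mul]
    ring

lemma one_sub_mul_mk_pow (a : K) : (1 - C a * X) * PowerSeries.mk (fun j => a ^ j) = 1 := by
  ext j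
  rcases j with _ | j
  · simp [sub_mul]
  · rw [sub_mul, one_mul, mul_assoc, map_sub, coeff_C_mul, coeff_succ_X_mul]
    simp [pow_succ', coeff_one]

/-- The quotient `(1 - (a + 1) X) / (1 - a X)`. -/
def shiftFactor (a : K) : PowerSeries K :=
  (1 - C (a + 1) * X) * PowerSeries.mk (fun j => a ^ j)

lemma derivative_one_sub (a : K) : d⁄dX K (1 - C a * X : PowerSeries K)
    = (1 - C a * X) * (- (C a * PowerSeries.mk (fun j => a ^ j))) := by
  have h := one_sub_mul_mk_pow a
  have e : d⁄dX K (1 - C a * X : PowerSeries K) = - C a := by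
    rw [map_sub, Derivation.leibniz, Derivation.map_one_eq_zero, derivative_X, derivative_C]
    simp
  rw [e]
  linear_combination (C a) * h

/-- The logarithmic derivative of 1 - aX is -a / (1 - aX), so that of the quotient is a difference
of two geometric series. -/
lemma derivative_shiftFactor (a : K) : d⁄dX K (shiftFactor a)
    = shiftFactor a * PowerSeries.mk (fun j => - ((a + 1) ^ (j + 1) - a ^ (j + 1))) := by
  have h := one_sub_mul_mk_pow a
  have hs : PowerSeries.mk (fun j => - ((a + 1) ^ (j + 1) - a ^ (j + 1)))
      = C a * PowerSeries.mk (fun j => a ^ j)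
        - C (a + 1) * PowerSeries.mk (fun j => (a + 1) ^ j) := by
    ext j
    simp only [coeff_mk, map_sub, coeff_C_mul]
    ring
  have hg : d⁄dX K (PowerSeries.mk (fun j => a ^ j))
      = PowerSeries.mk (fun j => a ^ j) * (C a * PowerSeries.mk (fun j => a ^ j)) := by
    rw [Derivation.leibniz_of_mul_eq_one _ ((mul_comm _ _).trans h), derivative_one_sub,
      smul_eq_mul]
    linear_combination (C a * PowerSeries.mk (fun j => a ^ j) ^ 2) * h
  rw [hs, shiftFactor, Derivation.leibniz, hg, derivative_one_sub, smul_eq_mul, smul_eq_mul]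
  ring

/-- A power series with constant coefficient `1` determines its logarithmic derivative, coefficient
by coefficient. -/
lemma coeff_logDeriv_eq {Q Q' S S' : PowerSeries K} (hQ : d⁄dX K Q = Q * S)
    (hQ' : d⁄dX K Q' = Q' * S') (h0 : coeff 0 Q = 1) (N : ℕ)
    (h : ∀ j ≤ N + 1, coeff j Q = coeff j Q') : ∀ j ≤ N, coeff j S = coeff j S' := by
  intro j
  induction j using Nat.strong_induction_on with
  | _ j ih =>
    intro hj
    have e := congrArg (coeff j) hQ
    have e' := congrArg (coeff j) hQ'
    have h0' : coeff 0 Q' = 1 := by rw [← h 0 (Nat.zero_le _), h0]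
    -- Coefficient j reads (j + 1) q_{j+1} = ∑ q_m s_{j-m}; as q_0 = 1, it expresses s_j through
    -- earlier s and the q up to index j + 1.
    rw [coeff_derivative, coeff_mul, Nat.sum_antidiagonal_eq_sum_range_succ_mk,
      sum_range_succ'] at e e'
    have hsum : ∑ m ∈ range j, coeff (m + 1) Q * coeff (j - (m + 1)) S
        = ∑ m ∈ range j, coeff (m + 1) Q' * coeff (j - (m + 1)) S' := by
      refine sum_congr rfl fun m hm => ?_
      have := mem_range.1 hm
      rw [h (m + 1) (by omega), ih (j - (m + 1)) (by omega) (by omega)]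
    simp only [h0, h0', one_mul, Nat.sub_zero] at e e'
    rw [hsum, h (j + 1) (by omega), e'] at e
    exact (add_left_cancel e).symm

/-- If `∏ᵢ (1 - (aᵢ + 1) X) / (1 - aᵢ X)` and `∏ᵢ (1 - (bᵢ + 1) X) / (1 - bᵢ X)` agree up to the
coefficient of `X ^ (N + 1)`, then the power sums of `a` and `b` agree up to the exponent `N`. -/
lemma sum_pow_eq_of_prod_shiftFactor [CharZero K] {α : Type*} [Fintype α] (a b : α → K) (N : ℕ)
    (h : ∀ j ≤ N + 1, coeff j (∏ i, shiftFactor (a i)) = coeff j (∏ i, shiftFactor (b i))) :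
    ∀ j ≤ N, ∑ i, a i ^ j = ∑ i, b i ^ j := by
  have h0 : coeff 0 (∏ i, shiftFactor (a i)) = 1 := by
    rw [coeff_zero_eq_constantCoeff_apply, map_prod]
    refine prod_eq_one fun i _ => ?_
    simp [shiftFactor]
  have key := coeff_logDeriv_eq
    (Derivation.prod_of_eq_mul _ univ _ _ fun i _ => derivative_shiftFactor (a i))
    (Derivation.prod_of_eq_mul _ univ _ _ fun i _ => derivative_shiftFactor (b i)) h0 N h
  refine sum_pow_eq_of_sum_forward_difference_eq univ univ a b N fun j hj => ?_
  have := key j hj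
  simp only [map_sum, coeff_mk, sum_neg_distrib] at this
  exact neg_injective this

/-- The solution of the triangular recursion `c (p + 1) i = m i * c p i - ∑_{l > i} c p l`. -/
lemma one_sub_X_mul_eq_prod_shiftFactor {n : ℕ} (m : Fin n → K) (c : ℕ → Fin n → K)
    (h0 : ∀ i, c 0 i = 1)
    (hc : ∀ p i, c (p + 1) i = m i * c p i - ∑ l ∈ Ioi i, c p l) :
    1 - X * PowerSeries.mk (fun p => ∑ i, c p i) = ∏ i, shiftFactor (m i) := by
  induction n with
  | zero =>
    simp only [univ_eq_empty, sum_empty, prod_empty]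
    rw [show PowerSeries.mk (fun _ => (0 : K)) = 0 from rfl, mul_zero, sub_zero]
  | succ n ih =>
    have hs : ∀ (i : Fin n) (g : Fin (n + 1) → K),
        ∑ l ∈ Ioi i.succ, g l = ∑ l ∈ Ioi i, g l.succ := by
      intro i g
      rw [← Fin.map_succEmb_Ioi, sum_map]
      rfl
    have h1 := ih (fun i => m i.succ) (fun p i => c p i.succ) (fun i => h0 _) fun p i => by
      rw [hc, hs]
    -- With c_i(X) = ∑ c p i X^p and P = 1 - X ∑_{i>0} c_i(X), the recursion at index 0 says (1 -
    -- m_0 X) c_0 = P. The full left side P - X c_0 is then (1 - (m_0 + 1) X) c_0, that is,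
    -- `shiftFactor (m 0)` times P.
    have h2 : (1 - C (m 0) * X) * PowerSeries.mk (fun p => c p 0)
        = 1 - X * PowerSeries.mk (fun p => ∑ i : Fin n, c p i.succ) := by
      ext p
      rcases p with _ | p
      · simp [sub_mul, h0]
      · have : ∑ l ∈ Ioi (0 : Fin (n + 1)), c p l = ∑ i : Fin n, c p i.succ := by
          rw [Fin.Ioi_zero_eq_map, sum_map]
          rfl
        rw [sub_mul, one_mul, mul_assoc, map_sub, coeff_C_mul, coeff_succ_X_mul, map_sub,
          coeff_succ_X_mul, coeff_mk, coeff_mk, coeff_mk, hc, this]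
        simp [coeff_one]
    have h3 : PowerSeries.mk (fun p => ∑ i, c p i)
        = PowerSeries.mk (fun p => c p 0)
          + PowerSeries.mk (fun p => ∑ i : Fin n, c p i.succ) := by
      ext p
      simp [Fin.sum_univ_succ]
    have h4 := one_sub_mul_mk_pow (m 0)
    rw [Fin.prod_univ_succ, ← h1, h3, ← h2, shiftFactor, map_add, map_one]
    have h5 : PowerSeries.mk (fun p => ∑ i : Fin n, c p i.succ) * X
        = 1 - (1 - C (m 0) * X) * PowerSeries.mk (fun p => c p 0) := by
      rw [h2]; ring
    linear_combination -h5 - (1 - (C (m 0) + 1) * X) * PowerSeries.mk (fun p => c p 0) * h4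

end GeneratingFunction

/-! ### Jacobi's formula for derivations -/

section DetDerivation

variable {R A ι : Type*} [CommRing R] [CommRing A] [Algebra R A]

/-- The ring homomorphism `a ↦ a + D a ε` attached to a derivation. -/
def Derivation.toDualNumberHom (D : Derivation R A A) : A →+* DualNumber A where
  toFun a := TrivSqZeroExt.inl a + TrivSqZeroExt.inr (D a)
  map_one' := by ext <;> simp
  map_zero' := by ext <;> simp
  map_add' a b := by ext <;> simp
  map_mul' a b := by ext <;> simp [mul_comm]

/-- Jacobi's formula: if a derivation maps a matrix `M` entrywise to `Y * M`, then it maps `det M` to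
`tr Y * det M`. -/
lemma Derivation.det_of_map_eq_mul [Fintype ι] [DecidableEq ι] (D : Derivation R A A)
    (M Y : Matrix ι ι A) (h : ∀ i j, D (M i j) = (Y * M) i j) :
    D M.det = Y.trace * M.det := by
  let inl : A →+* DualNumber A := TrivSqZeroExt.inlHom A A
  -- Over the dual numbers M becomes (1 + εY) M, and det (1 + εY) = 1 + ε tr Y because ε² = 0.
  have hM : D.toDualNumberHom.mapMatrix M
      = (1 + DualNumber.eps (R := A) • inl.mapMatrix Y) * inl.mapMatrix M := by
    rw [add_mul, one_mul, smul_mul_assoc, ← map_mul]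
    ext i j
    · simp [toDualNumberHom, inl]
    · simp only [RingHom.mapMatrix_apply, Matrix.map_apply, Matrix.add_apply, Matrix.smul_apply]
      simp [toDualNumberHom, inl, h]
  have hd := congrArg Matrix.det hM
  rw [← RingHom.map_det, Matrix.det_mul, Matrix.det_one_add_smul, ← RingHom.map_det, pow_two,
    DualNumber.eps_mul_eps, mul_zero, add_zero] at hd
  have := congrArg TrivSqZeroExt.snd hd
  have ht : (inl.mapMatrix Y).trace = inl Y.trace := by
    simp [Matrix.trace]
  rw [ht] at this
  simpa [toDualNumberHom, inl, mul_comm] using this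

end DetDerivation

/-! ### A polynomial highest weight vector; the Verma module is nonzero -/

namespace SLn

open MvPolynomial

/-- The derivation of the polynomial ring in the entries of an `n × n` matrix that sends the
`j`-th row to `∑ᵢ x i j` times the `i`-th row. -/
def rowDerivation {n : ℕ} (x : Matrix (Fin n) (Fin n) ℂ) :
    Derivation ℂ (MvPolynomial (Fin n × Fin n) ℂ) (MvPolynomial (Fin n × Fin n) ℂ) :=
  mkDerivation ℂ fun q => ∑ i, x i q.1 • MvPolynomial.X (i, q.2)

lemma rowDerivation_X {n : ℕ} (x : Matrix (Fin n) (Fin n) ℂ) (j l : Fin n) :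
    rowDerivation x (MvPolynomial.X (j, l)) = ∑ i, x i j • MvPolynomial.X (i, l) :=
  mkDerivation_X _ _ _

/-- The action of `sl_n(ℂ)` on polynomials in the entries of a matrix. -/
def polyAction (n : ℕ) : sl n →ₗ⁅ℂ⁆ Module.End ℂ (MvPolynomial (Fin n × Fin n) ℂ) where
  toFun x := (rowDerivation x.1 : MvPolynomial (Fin n × Fin n) ℂ →ₗ[ℂ] _)
  map_add' x y := by
    rw [← Derivation.coe_add_linearMap]
    congr 1
    refine MvPolynomial.derivation_ext fun q => ?_
    rw [Derivation.add_apply, rowDerivation_X, rowDerivation_X, rowDerivation_X,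
      ← Finset.sum_add_distrib]
    exact Finset.sum_congr rfl fun i _ => add_smul _ _ _
  map_smul' c x := by
    rw [RingHom.id_apply, ← Derivation.coe_smul_linearMap]
    congr 1
    refine MvPolynomial.derivation_ext fun q => ?_
    rw [Derivation.smul_apply, rowDerivation_X, rowDerivation_X, Finset.smul_sum]
    exact Finset.sum_congr rfl fun i _ => mul_smul _ _ _
  map_lie' {x y} := by
    rw [← Derivation.commutator_coe_linear_map]
    congr 1
    refine MvPolynomial.derivation_ext fun q => ?_
    have hmul : ∀ a b : Matrix (Fin n) (Fin n) ℂ,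
        rowDerivation a (rowDerivation b (MvPolynomial.X q))
          = ∑ i, (a * b) i q.1 • MvPolynomial.X (i, q.2) := by
      intro a b
      rw [rowDerivation_X, map_sum]
      simp only [Derivation.map_smul, rowDerivation_X, Finset.smul_sum, Matrix.mul_apply,
        Finset.sum_smul, smul_smul]
      rw [Finset.sum_comm]
      simp only [mul_comm]
    rw [Derivation.commutator_apply, hmul, hmul, rowDerivation_X, ← Finset.sum_sub_distrib,
      LieAlgebra.SpecialLinear.sl_bracket]
    exact Finset.sum_congr rfl fun i _ => by rw [Matrix.sub_apply, sub_smul]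

/-- The leading principal minor of size `m` of the generic `n × n` matrix. -/
def principalMinor (n m : ℕ) : MvPolynomial (Fin n × Fin n) ℂ :=
  (Matrix.of fun i j : {i : Fin n // i.val < m} => MvPolynomial.X (i.1, j.1)).det

lemma principalMinor_ne_zero (n m : ℕ) : principalMinor n m ≠ 0 := by
  intro h
  have := congrArg (MvPolynomial.eval fun q : Fin n × Fin n => if q.1 = q.2 then (1 : ℂ) else 0) h
  rw [principalMinor, RingHom.map_det, map_zero] at this
  have h1 : (MvPolynomial.eval fun q : Fin n × Fin n => if q.1 = q.2 then (1 : ℂ) else 0).mapMatrix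
      (Matrix.of fun i j : {i : Fin n // i.val < m} => MvPolynomial.X (i.1, j.1)) = 1 := by
    ext i j
    simp [Matrix.one_apply, Subtype.ext_iff]
  rw [h1, Matrix.det_one] at this
  exact one_ne_zero this

/-- An upper triangular x sends row j to a combination of rows i ≤ j, so it preserves the span of
the first m rows; Jacobi's formula yields the trace of the leading block, which is ω_m(x). -/
lemma rowDerivation_principalMinor {n : ℕ} (m : ℕ) (x : Matrix (Fin n) (Fin n) ℂ)
    (hx : ∀ i j, j < i → x i j = 0) :
    rowDerivation x (principalMinor n m)
      = principalMinor n m * MvPolynomial.C (∑ i : Fin n, if i.val < m then x i i else 0) := by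
  rw [principalMinor, Derivation.det_of_map_eq_mul _ _
    (Matrix.of fun i j : {i : Fin n // i.val < m} => MvPolynomial.C (x j.1 i.1)), mul_comm]
  · congr 1
    rw [Matrix.trace, ← Finset.sum_filter, map_sum]
    exact (Finset.sum_subtype _ (by simp) fun i => MvPolynomial.C (x i i)).symm
  · intro i j
    rw [Matrix.of_apply, rowDerivation_X, Matrix.mul_apply]
    simp only [Matrix.of_apply, ← MvPolynomial.smul_eq_C_mul]
    rw [← Finset.sum_subtype (Finset.univ.filter fun i : Fin n => i.val < m) (by simp)
      fun l => x l i.1 • (MvPolynomial.X (l, j.1) : MvPolynomial (Fin n × Fin n) ℂ)]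
    refine (Finset.sum_subset (Finset.filter_subset _ _) fun l _ hl => ?_).symm
    have hl' : ¬ l.val < m := by simpa using hl
    have : i.1 < l := by
      have := i.2
      rw [Fin.lt_def]
      omega
    rw [hx l i.1 this, zero_smul]

/-- A product of leading principal minors, a highest weight vector of weight
`∑ₘ a m • ω_{m + 1}`. -/
def minorProduct (n : ℕ) (a : ℕ → ℕ) : MvPolynomial (Fin n × Fin n) ℂ :=
  ∏ m ∈ Finset.range (n - 1), principalMinor n (m + 1) ^ a m

lemma minorProduct_ne_zero (n : ℕ) (a : ℕ → ℕ) : minorProduct n a ≠ 0 :=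
  Finset.prod_ne_zero_iff.2 fun _ _ => pow_ne_zero _ (principalMinor_ne_zero _ _)

lemma rowDerivation_minorProduct {n : ℕ} (a : ℕ → ℕ) (x : Matrix (Fin n) (Fin n) ℂ)
    (hx : ∀ i j, j < i → x i j = 0) :
    rowDerivation x (minorProduct n a) = (∑ m ∈ Finset.range (n - 1),
      (a m : ℂ) * ∑ i : Fin n, if i.val < m + 1 then x i i else 0) • minorProduct n a := by
  rw [minorProduct, Derivation.prod_of_eq_mul _ _ _
    (fun m => MvPolynomial.C ((a m : ℂ) * ∑ i : Fin n, if i.val < m + 1 then x i i else 0)),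
    ← map_sum, mul_comm, ← MvPolynomial.smul_eq_C_mul]
  intro m _
  rw [Derivation.leibniz_pow, rowDerivation_principalMinor _ _ hx]
  -- The exponent `a m - 1` in the Leibniz rule is a truncated subtraction.
  rcases Nat.eq_zero_or_pos (a m) with h | h
  · simp [h]
  · obtain ⟨b, hb⟩ := Nat.exists_eq_add_of_lt h
    rw [hb, show 0 + b + 1 - 1 = b by omega, pow_succ, map_mul]
    simp only [smul_eq_mul, nsmul_eq_mul, map_natCast]
    ring

/-- The values of a weight on the diagonal elements `X_{ii}`, in terms of the simple coroots. -/
lemma weight_Xdiag {n : ℕ} (μ : Weight n) (a : ℕ → ℕ)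
    (ha : ∀ (i : ℕ) (hi : i + 1 < n), μ (simpleCoroot i hi) = a i) (h0 : 0 < n) (i : ℕ)
    (hi : i < n) :
    μ (Xdiag ⟨i, hi⟩) = μ (Xdiag ⟨0, h0⟩) - ∑ m ∈ Finset.range i, (a m : ℂ) := by
  induction i with
  | zero => simp
  | succ i ih =>
    have := ha i hi
    rw [simpleCoroot, map_sub, ih (Nat.lt_of_succ_lt hi)] at this
    rw [Finset.sum_range_succ]
    linear_combination -this

lemma cartan_eq_sum {n : ℕ} (h : cartan n) : h = ∑ i, h.1.1 i i • Xdiag i := by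
  apply Subtype.ext
  rw [AddSubmonoidClass.coe_finsetSum]
  conv_lhs => rw [sl_eq_sum h.1]
  refine Finset.sum_congr rfl fun i _ => ?_
  rw [Finset.sum_eq_single i]
  · rfl
  · intro j _ hj
    rw [h.2 i j hj.symm, zero_smul]
  · exact fun h => absurd (Finset.mem_univ i) h

/-- The values μ(X_ii) are known up to a common constant, which vanishing trace removes; summation
by parts gives μ = ∑ a_m ω_{m+1}. -/
lemma weight_eq_sum {n : ℕ} (μ : Weight n) (a : ℕ → ℕ)
    (ha : ∀ (i : ℕ) (hi : i + 1 < n), μ (simpleCoroot i hi) = a i) (h : cartan n) :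
    μ h = ∑ m ∈ Finset.range (n - 1),
      (a m : ℂ) * ∑ i : Fin n, if i.val < m + 1 then h.1.1 i i else 0 := by
  have ht : ∑ i, h.1.1 i i = 0 := LinearMap.mem_ker.1 h.1.2
  rcases Nat.eq_zero_or_pos n with rfl | h0
  · rw [cartan_eq_sum h]
    simp
  have e1 : μ h = - ∑ i : Fin n, h.1.1 i i * ∑ m ∈ Finset.range i.val, (a m : ℂ) := by
    conv_lhs => rw [cartan_eq_sum h]
    rw [map_sum]
    simp only [map_smul, smul_eq_mul]
    rw [Finset.sum_congr rfl fun i _ => by rw [weight_Xdiag μ a ha h0 i.val i.2, mul_sub],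
      Finset.sum_sub_distrib, ← Finset.sum_mul, ht, zero_mul, zero_sub]
  have e2 : ∀ m, (∑ i : Fin n, if i.val < m + 1 then h.1.1 i i else 0)
      = - ∑ i : Fin n, if m < i.val then h.1.1 i i else 0 := by
    intro m
    rw [eq_neg_iff_add_eq_zero, ← Finset.sum_add_distrib]
    refine Eq.trans ?_ ht
    refine Finset.sum_congr rfl fun i _ => ?_
    by_cases hm : m < i.val
    · rw [if_neg (by omega), if_pos hm, zero_add]
    · rw [if_pos (by omega), if_neg hm, add_zero]
  simp only [e1, e2, mul_neg, Finset.sum_neg_distrib, Finset.mul_sum]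
  rw [Finset.sum_comm (s := Finset.range (n - 1))]
  congr 1
  refine Finset.sum_congr rfl fun i _ => ?_
  simp only [mul_ite, mul_zero]
  rw [← Finset.sum_filter]
  have : (Finset.range (n - 1)).filter (fun m => m < i.val) = Finset.range i.val := by
    ext m
    simp only [Finset.mem_filter, Finset.mem_range]
    have := i.2
    omega
  rw [this]
  exact Finset.sum_congr rfl fun m _ => mul_comm _ _

/-- The annihilator of `w` in the polynomial representation is a left ideal containing the
generators of `vermaIdeal μ`, but not 1, since `w` is nonzero. -/
lemma one_notMem_vermaIdeal {n : ℕ} {μ : Weight n} (hμ : IsDominantIntegral μ) :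
    (1 : U n) ∉ vermaIdeal μ := by
  choose! a ha using hμ
  let w := minorProduct n a
  let ρ : U n →ₐ[ℂ] Module.End ℂ (MvPolynomial (Fin n × Fin n) ℂ) :=
    UniversalEnvelopingAlgebra.lift ℂ (polyAction n)
  have hρ : ∀ (x : sl n), (∀ i j, j < i → x.1 i j = 0) →
      ρ (ι n x) w = (∑ m ∈ Finset.range (n - 1),
        (a m : ℂ) * ∑ i : Fin n, if i.val < m + 1 then x.1 i i else 0) • w := by
    intro x hx
    rw [UniversalEnvelopingAlgebra.lift_ι_apply]
    exact rowDerivation_minorProduct a x.1 hx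
  let N : Submodule (U n) (U n) :=
    { carrier := {u | ρ u w = 0}
      add_mem' := fun {u v} hu hv => by
        simp only [Set.mem_ofPred_eq] at *
        rw [map_add, LinearMap.add_apply, hu, hv, add_zero]
      zero_mem' := by simp
      smul_mem' := fun c u hu => by
        simp only [Set.mem_ofPred_eq] at *
        rw [smul_eq_mul, map_mul, Module.End.mul_apply, hu, map_zero] }
  have hN : vermaIdeal μ ≤ N := by
    refine Submodule.span_le.2 ?_
    rintro u (⟨i, j, hij, rfl⟩ | ⟨h, rfl⟩)
    · have hX : ∀ k l, ¬ (i = k ∧ j = l) → (X i j).1 k l = 0 := by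
        intro k l hkl
        simp [X, hij.ne, hkl]
      change ρ (ι n (X i j)) w = 0
      rw [hρ]
      · rw [Finset.sum_eq_zero, zero_smul]
        intro m _
        rw [Finset.sum_eq_zero, mul_zero]
        intro k _
        rw [hX k k, ite_self]
        rintro ⟨rfl, rfl⟩
        exact hij.ne rfl
      · intro k l hlk
        refine hX k l ?_
        rintro ⟨rfl, rfl⟩
        exact lt_asymm hij hlk
    · change ρ (ι n h.1 - algebraMap ℂ (U n) (μ h)) w = 0
      rw [map_sub, LinearMap.sub_apply, hρ _ fun i j hij => h.2 i j hij.ne', AlgHom.commutes,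
        Module.algebraMap_end_apply, ← weight_eq_sum μ a ha, sub_self]
  intro h1
  have : ρ 1 w = 0 := hN h1
  rw [map_one, Module.End.one_apply] at this
  exact minorProduct_ne_zero n a this

end SLn

/-! ### Grading of highest weight modules and nonvanishing of V_μ -/

namespace SLn

/-- A Cartan element `H` with `[H, X_{ij}] = (j - i) X_{ij}`, whose eigenvalues grade a highest
weight module. -/
def gradingElement (n : ℕ) : cartan n := ∑ k : Fin n, (-(k.val : ℂ)) • Xdiag k

lemma ι_gradingElement (n : ℕ) :
    ι n (gradingElement n).1 = ∑ k : Fin n, (-(k.val : ℂ)) • ι n (X k k) := by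
  rw [gradingElement, AddSubmonoidClass.coe_finsetSum, map_sum]
  exact Finset.sum_congr rfl fun k _ => map_smul (ι n) _ (X k k)

lemma gradingElement_commutator {n : ℕ} (i j : Fin n) :
    ι n (gradingElement n).1 * ι n (X i j)
      = ι n (X i j) * ι n (gradingElement n).1 + ((j.val : ℂ) - i.val) • ι n (X i j) := by
  rw [← sub_eq_iff_eq_add', ι_gradingElement, Finset.sum_mul, Finset.mul_sum,
    ← Finset.sum_sub_distrib]
  simp only [smul_mul_assoc, mul_smul_comm, ← smul_sub, X_commutator]
  simp only [smul_sub, smul_ite, smul_zero, Finset.sum_sub_distrib, Finset.sum_ite_eq,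
    Finset.sum_ite_eq', Finset.mem_univ, if_true]
  module

section HighestWeightModule

variable {n : ℕ} {W : Type*} [AddCommGroup W] [Module ℂ W] [Module (U n) W]
  [IsScalarTower ℂ (U n) W]

/-- The vectors obtained from `w` by applying lowering operators. -/
inductive LoweringMonomial (n : ℕ) {W : Type*} [AddCommGroup W] [Module (U n) W] (w : W) : W → Prop
  | base : LoweringMonomial n w w
  | step (i j : Fin n) (hij : j < i) (v : W) :
      LoweringMonomial n w v → LoweringMonomial n w (ι n (X i j) • v)

lemma smul_complex_comm (u : U n) (c : ℂ) (v : W) : u • c • v = c • u • v := by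
  rw [← algebraMap_smul (U n) c v, ← algebraMap_smul (U n) c (u • v), ← mul_smul, ← mul_smul,
    Algebra.commutes]

variable (n) in
/-- The span of the eigenspaces of `gradingElement n` with eigenvalues `c - 1, c - 2, …`. -/
def lowerPart (W : Type*) [AddCommGroup W] [Module ℂ W] [Module (U n) W]
    [IsScalarTower ℂ (U n) W] (c : ℂ) : Submodule ℂ W :=
  ⨆ d : ℕ, Module.End.eigenspace (Algebra.lsmul ℂ ℂ W (ι n (gradingElement n).1)) (c - (d + 1))

lemma mem_eigenspace_gradingElement {c : ℂ} {v : W} :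
    v ∈ Module.End.eigenspace (Algebra.lsmul ℂ ℂ W (ι n (gradingElement n).1)) c
      ↔ ι n (gradingElement n).1 • v = c • v :=
  Module.End.mem_eigenspace_iff

lemma map_mem_lowerPart {W' : Type*} [AddCommGroup W'] [Module ℂ W'] [Module (U n) W']
    [IsScalarTower ℂ (U n) W'] (f : W →ₗ[U n] W') (c : ℂ) {p : W} (hp : p ∈ lowerPart n W c) :
    f p ∈ lowerPart n W' c := by
  refine Submodule.iSup_induction _ (motive := fun p => f p ∈ lowerPart n W' c) hp
    (fun d v hv => ?_) ?_ fun x y hx hy => ?_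
  · refine Submodule.mem_iSup_of_mem d ?_
    rw [mem_eigenspace_gradingElement] at hv ⊢
    rw [← map_smul f, hv, ← algebraMap_smul (U n), map_smul, algebraMap_smul]
  · rw [map_zero]
    exact Submodule.zero_mem _
  · rw [map_add]
    exact Submodule.add_mem _ hx hy

/-- Eigenspaces are independent, and c is none of c - 1, c - 2, …. -/
lemma eq_zero_of_mem_lowerPart {c : ℂ} {v : W} (hv : ι n (gradingElement n).1 • v = c • v)
    (h : v ∈ lowerPart n W c) : v = 0 := by
  have hd := Module.End.eigenspaces_iSupIndep
    (Algebra.lsmul ℂ ℂ W (ι n (gradingElement n).1)) c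
  refine (Submodule.disjoint_def.1 hd) v ?_ ?_
  · exact mem_eigenspace_gradingElement.2 hv
  · refine (iSup_le fun d => ?_ : lowerPart n W c ≤ _) h
    refine le_iSup₂_of_le (c - (d + 1)) ?_ le_rfl
    intro e
    have : ((d : ℂ) + 1) = 0 := by linear_combination -e
    exact Nat.cast_add_one_ne_zero d this

/-- Each lowering operator X_ij decreases the eigenvalue by i - j ≥ 1, so degree 0 contains only the
empty monomial. -/
lemma LoweringMonomial.grading {c : ℂ} {w v : W}
    (hw : ι n (gradingElement n).1 • w = c • w) (hv : LoweringMonomial n w v) :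
    ∃ d : ℕ, (d = 0 → v = w) ∧ ι n (gradingElement n).1 • v = (c - d) • v := by
  induction hv with
  | base => exact ⟨0, fun _ => rfl, by simpa using hw⟩
  | step i j hij v _ ih =>
    obtain ⟨d, -, hd⟩ := ih
    have hij' : j.val < i.val := hij
    refine ⟨d + (i.val - j.val), fun h => by omega, ?_⟩
    rw [← mul_smul, gradingElement_commutator, add_smul, mul_smul, hd, smul_complex_comm,
      smul_assoc, ← add_smul, Nat.cast_add, Nat.cast_sub hij'.le]
    congr 1
    ring

lemma smul_mem_span_loweringMonomial {μ : Weight n} {w : W}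
    (hraise : ∀ i j : Fin n, i < j → ι n (X i j) • w = 0)
    (hcartan : ∀ h : cartan n, ι n h.1 • w = μ h • w) (u : U n) :
    u • w ∈ Submodule.span ℂ {v | LoweringMonomial n w v} := by
  set L := Submodule.span ℂ {v | LoweringMonomial n w v}
  have smul_mem : ∀ x : U n, (∀ v, LoweringMonomial n w v → x • v ∈ L) →
      ∀ v ∈ L, x • v ∈ L := by
    intro x hx v hv
    induction hv using Submodule.span_induction with
    | mem v hv => exact hx v hv
    | zero => rw [smul_zero]; exact L.zero_mem
    | add v v' _ _ h h' => rw [smul_add]; exact L.add_mem h h'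
    | smul c v _ h => rw [smul_complex_comm]; exact L.smul_mem c h
  have hX : ∀ v, LoweringMonomial n w v → ∀ k l : Fin n, ι n (X k l) • v ∈ L := by
    intro v hv
    induction hv with
    | base =>
      intro k l
      rcases lt_trichotomy k l with h | rfl | h
      · rw [hraise k l h]
        exact L.zero_mem
      · have := hcartan (Xdiag k)
        change ι n (X k k) • w = _ at this
        rw [this]
        exact L.smul_mem _ (Submodule.subset_span LoweringMonomial.base)
      · exact Submodule.subset_span (LoweringMonomial.step k l h w .base)
    -- Move X_kl past the outermost lowering operator; the commutator terms are again X's acting on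
    -- the shorter monomial `v`, so the induction must cover all k, l.
    | step i j hij v _ ih =>
      intro k l
      have e := sub_eq_iff_eq_add'.1 (X_commutator k l i j)
      rw [← mul_smul, e, add_smul, sub_smul, mul_smul]
      refine L.add_mem (smul_mem _
        (fun v' hv' => Submodule.subset_span (LoweringMonomial.step i j hij v' hv')) _ (ih k l))
        (L.sub_mem ?_ ?_)
      · split_ifs
        · exact ih _ _
        · rw [zero_smul]
          exact L.zero_mem
      · split_ifs
        · exact ih _ _
        · rw [zero_smul]
          exact L.zero_mem
  let S : Subalgebra ℂ (U n) :=
    { carrier := {u | ∀ v ∈ L, u • v ∈ L}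
      mul_mem' := fun {a b} ha hb v hv => by
        rw [mul_smul]
        exact ha _ (hb _ hv)
      add_mem' := fun {a b} ha hb v hv => by
        rw [add_smul]
        exact L.add_mem (ha _ hv) (hb _ hv)
      algebraMap_mem' := fun c v hv => by
        rw [algebraMap_smul]
        exact L.smul_mem c hv }
  refine mem_of_generators S (fun x => ?_) u w (Submodule.subset_span LoweringMonomial.base)
  rw [sl_eq_sum x]
  simp only [map_sum, map_smul]
  exact S.sum_mem fun i _ => S.sum_mem fun j _ =>
    S.smul_mem (fun v hv => smul_mem _ (fun v' hv' => hX v' hv' i j) v hv) _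

/-- In a module generated by a highest weight vector `w`, every vector is a multiple of `w` up to
vectors of lower degree. -/
lemma exists_eq_smul_add_lowerPart {μ : Weight n} {w : W}
    (hraise : ∀ i j : Fin n, i < j → ι n (X i j) • w = 0)
    (hcartan : ∀ h : cartan n, ι n h.1 • w = μ h • w) (u : U n) :
    ∃ a : ℂ, ∃ p ∈ lowerPart n W (μ (gradingElement n)), u • w = a • w + p := by
  have hle : Submodule.span ℂ {v | LoweringMonomial n w v}
      ≤ Submodule.span ℂ {w} ⊔ lowerPart n W (μ (gradingElement n)) := by
    refine Submodule.span_le.2 fun v hv => ?_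
    obtain ⟨d, h0, hd⟩ := LoweringMonomial.grading (hcartan (gradingElement n)) hv
    rcases d with _ | d
    · rw [h0 rfl]
      exact Submodule.mem_sup_left (Submodule.mem_span_singleton_self w)
    · refine Submodule.mem_sup_right (Submodule.mem_iSup_of_mem d ?_)
      rw [mem_eigenspace_gradingElement, hd, Nat.cast_succ]
  obtain ⟨y, hy, p, hp, e⟩ :=
    Submodule.mem_sup.1 (hle (smul_mem_span_loweringMonomial hraise hcartan u))
  obtain ⟨a, rfl⟩ := Submodule.mem_span_singleton.1 hy
  exact ⟨a, p, hp, e.symm⟩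

end HighestWeightModule

/-- For dominant integral `μ`, the module `V_μ` is nonzero. -/
lemma hwVector_ne_zero {n : ℕ} {μ : Weight n} (hμ : IsDominantIntegral μ) : hwVector μ ≠ 0 := by
  let v : Verma μ := Submodule.Quotient.mk 1
  have hgen : ∀ x : Verma μ, ∃ u : U n, x = u • v := by
    intro x
    obtain ⟨u, rfl⟩ := Submodule.Quotient.mk_surjective _ x
    exact ⟨u, by rw [← Submodule.Quotient.mk_smul, smul_eq_mul, mul_one]⟩
  have hmem : ∀ u ∈ vermaIdeal μ, u • v = 0 := by
    intro u hu
    rw [← Submodule.Quotient.mk_smul, smul_eq_mul, mul_one, (Submodule.Quotient.mk_eq_zero _).2 hu]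
  have hraise : ∀ i j : Fin n, i < j → ι n (X i j) • v = 0 := fun i j hij =>
    hmem _ (Submodule.subset_span (Or.inl ⟨i, j, hij, rfl⟩))
  have hcartan : ∀ h : cartan n, ι n h.1 • v = μ h • v := by
    intro h
    have := hmem _ (Submodule.subset_span (Or.inr ⟨h, rfl⟩))
    rwa [sub_smul, sub_eq_zero, algebraMap_smul] at this
  set c := μ (gradingElement n)
  -- Let a v + p, with p of lower degree, lie in a proper submodule N. Modulo N, a v = -p has
  -- eigenvalue c and lies in the lower part, so it vanishes; v ∉ N forces a = 0. Thus every proper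
  -- N, and so their sum, lies in the lower part.
  have hlow : ∀ x ∈ sSup {N : Submodule (U n) (Verma μ) | N ≠ ⊤},
      x ∈ lowerPart n (Verma μ) c := by
    intro x hx
    rw [sSup_eq_iSup'] at hx
    refine Submodule.iSup_induction _ (motive := fun x => x ∈ lowerPart n (Verma μ) c) hx
      (fun N x hxN => ?_) (Submodule.zero_mem _) fun _ _ => Submodule.add_mem _
    obtain ⟨u, rfl⟩ := hgen x
    obtain ⟨a, p, hp, e⟩ := exists_eq_smul_add_lowerPart hraise hcartan u
    have hvN : N.1.mkQ v ≠ 0 := by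
      intro h0
      have hv : v ∈ N.1 := (Submodule.Quotient.mk_eq_zero _).1 h0
      refine N.2 (eq_top_iff.2 fun y _ => ?_)
      obtain ⟨u, rfl⟩ := hgen y
      exact N.1.smul_mem u hv
    have hq : a • N.1.mkQ v + N.1.mkQ p = 0 := by
      have h1 : N.1.mkQ (u • v) = 0 := (Submodule.Quotient.mk_eq_zero _).2 hxN
      rwa [e, map_add, ← algebraMap_smul (U n) a v, map_smul, algebraMap_smul] at h1
    have hav : a • N.1.mkQ v = 0 := by
      refine eq_zero_of_mem_lowerPart (n := n) (c := c) ?_ ?_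
      · rw [smul_complex_comm, ← map_smul, hcartan, ← algebraMap_smul (U n) (μ _) v, map_smul,
          algebraMap_smul, smul_comm]
      · rw [eq_neg_of_add_eq_zero_left hq]
        exact Submodule.neg_mem _ (map_mem_lowerPart _ _ hp)
    rw [e, (smul_eq_zero.1 hav).resolve_right hvN, zero_smul, zero_add]
    exact hp
  intro h0
  have hv : v ∈ lowerPart n (Verma μ) c := hlow v ((Submodule.Quotient.mk_eq_zero _).1 h0)
  have : v = 0 := eq_zero_of_mem_lowerPart (hcartan _) hv
  exact one_notMem_vermaIdeal hμ ((Submodule.Quotient.mk_eq_zero _).1 this)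

/-! ### Casimir eigenvalues and shifted coordinates -/

/-- The generating function of the eigenvalues of the Casimir elements on `V_μ`. -/
lemma chi_casimir_generatingFunction {n : ℕ} {μ : Weight n} (hμ : IsDominantIntegral μ) :
    1 - PowerSeries.X * PowerSeries.mk (fun p => chi μ (casimir n p))
      = ∏ i, shiftFactor (μ (Xdiag i) + ((Finset.Ioi i).card : ℂ)) := by
  have hw := hwVector_ne_zero hμ
  have hinj : ∀ {a b : ℂ}, a • hwVector μ = b • hwVector μ → a = b := fun h =>
    smul_left_injective ℂ hw h
  have hup : ∀ (p : ℕ) (i j : Fin n), i < j → (XMat n ^ p) i j • hwVector μ = 0 := by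
    intro p i j hij
    obtain ⟨c, h0, e⟩ := XMat_pow_hwVector μ p i j hij.le
    rw [e, h0 hij, zero_smul]
  choose c _ hc using fun (p : ℕ) (i : Fin n) => XMat_pow_hwVector μ p i i le_rfl
  have hchi : ∀ p, chi μ (casimir n p) = ∑ i, c p i := by
    intro p
    apply hinj
    rw [← casimir_smul, casimir, Matrix.trace, Finset.sum_smul, Finset.sum_smul]
    exact Finset.sum_congr rfl fun i _ => hc p i
  simp only [hchi]
  refine one_sub_X_mul_eq_prod_shiftFactor _ c (fun i => ?_) fun p i => ?_
  · apply hinj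
    rw [← hc, pow_zero, Matrix.one_apply_eq, one_smul, one_smul]
  · have hterm : ∀ l : Fin n, ((XMat n ^ p) i l * ι n (X l i)) • hwVector μ
        = ((if l = i then μ (Xdiag i) * c p i else 0)
          + if i < l then c p i - c p l else 0) • hwVector μ := by
      intro l
      rcases lt_trichotomy l i with h | rfl | h
      · rw [mul_smul, raising_hwVector μ h, smul_zero, if_neg h.ne, if_neg h.not_gt, add_zero,
          zero_smul]
      · have := cartan_hwVector μ (Xdiag l)
        change ι n (X l l) • hwVector μ = _ at this
        rw [mul_smul, this, smul_comm_V, hc, smul_smul, if_pos rfl, if_neg (lt_irrefl _), add_zero]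
      · have comm := XMat_pow_commutator p l i i l
        rw [if_pos rfl, if_pos rfl, sub_eq_iff_eq_add, ← sub_eq_iff_eq_add'] at comm
        rw [← comm, sub_smul, sub_smul, mul_smul, hup p i l h, smul_zero, hc, hc, if_neg h.ne',
          if_pos h, zero_add, sub_smul, zero_sub, neg_sub]
    apply hinj
    rw [← hc, pow_succ, Matrix.mul_apply, Finset.sum_smul]
    refine (Finset.sum_congr rfl fun l _ => hterm l).trans ?_
    rw [← Finset.sum_smul]
    congr 1
    rw [Finset.sum_add_distrib, Finset.sum_ite_eq', if_pos (Finset.mem_univ _),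
      ← Finset.sum_filter, Finset.filter_lt_eq_Ioi, Finset.sum_sub_distrib, Finset.sum_const,
      nsmul_eq_mul]
    ring

lemma chi_casimir_zero {n : ℕ} {μ : Weight n} (hμ : IsDominantIntegral μ) :
    chi μ (casimir n 0) = n := by
  apply smul_left_injective ℂ (hwVector_ne_zero hμ)
  change _ • _ = _ • _
  rw [← casimir_smul, casimir, pow_zero, Matrix.trace_one, Fintype.card_fin, Nat.cast_smul_eq_nsmul,
    Nat.cast_smul_eq_nsmul]

lemma casimir_one (n : ℕ) : casimir n 1 = 0 := by
  have h : ∑ i : Fin n, X i i = 0 := by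
    apply Subtype.ext
    rw [AddSubmonoidClass.coe_finsetSum]
    rcases Nat.eq_zero_or_pos n with rfl | hn
    · exact Subsingleton.elim _ _
    have hn' : (n : ℂ) ≠ 0 := by exact_mod_cast hn.ne'
    simp only [X, if_true, Finset.sum_sub_distrib, Finset.sum_const, Finset.card_univ,
      Fintype.card_fin, ← Nat.cast_smul_eq_nsmul ℂ, smul_smul,
      mul_one_div_cancel hn', one_smul]
    rw [Matrix.sum_single_one, sub_self]
    rfl
  rw [casimir, pow_one, Matrix.trace]
  exact (map_sum (ι n) _ _).symm.trans (by rw [h, map_zero])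

lemma chi_casimir_one {n : ℕ} {μ : Weight n} (hμ : IsDominantIntegral μ) :
    chi μ (casimir n 1) = 0 := by
  apply smul_left_injective ℂ (hwVector_ne_zero hμ)
  change _ • _ = _ • _
  rw [← casimir_smul, casimir_one, zero_smul, zero_smul]

/-- The Casimir eigenvalues of degree at most `N` determine the power sums of degree at most `N` of
the shifted highest weight. -/
lemma sum_pow_eq_of_chi_casimir_eq {n : ℕ} {μ μ' : Weight n} (hμ : IsDominantIntegral μ)
    (hμ' : IsDominantIntegral μ') (N : ℕ)
    (h : ∀ p, 2 ≤ p → p ≤ N → chi μ (casimir n p) = chi μ' (casimir n p)) :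
    ∀ j ≤ N, ∑ i, (μ (Xdiag i) + ((Finset.Ioi i).card : ℂ)) ^ j
      = ∑ i, (μ' (Xdiag i) + ((Finset.Ioi i).card : ℂ)) ^ j := by
  refine sum_pow_eq_of_prod_shiftFactor _ _ N fun j hj => ?_
  rw [← chi_casimir_generatingFunction hμ, ← chi_casimir_generatingFunction hμ', map_sub, map_sub]
  congr 1
  -- Coefficient p + 1 carries C_p. The values at p = 0 and p = 1 are n and 0 for every weight, so
  -- only 2 ≤ p ≤ N needs the hypothesis.
  rcases j with _ | p
  · simp
  rw [PowerSeries.coeff_succ_X_mul, PowerSeries.coeff_succ_X_mul, PowerSeries.coeff_mk,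
    PowerSeries.coeff_mk]
  rcases p with _ | _ | p
  · rw [chi_casimir_zero hμ, chi_casimir_zero hμ']
  · rw [chi_casimir_one hμ, chi_casimir_one hμ']
  · exact h _ (by omega) (by omega)

lemma fundamentalWeight_succ_sub {n : ℕ} (j i : Fin n) :
    (fundamentalWeight n (j.val + 1) - fundamentalWeight n j.val) (Xdiag i)
      = (if i = j then 1 else 0) - 1 / (n : ℂ) := by
  rw [LinearMap.sub_apply]
  change (∑ a : Fin n, if a.val < j.val + 1 then (X i i).1 a a else 0)
    - (∑ a : Fin n, if a.val < j.val then (X i i).1 a a else 0) = _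
  rw [← Finset.sum_sub_distrib, Finset.sum_eq_single j]
  · simp [X, Matrix.single_apply]
  · intro a _ ha
    have ha' : a.val ≠ j.val := fun e => ha (Fin.ext e)
    by_cases h : a.val < j.val
    · rw [if_pos h, if_pos (by omega), sub_self]
    · rw [if_neg h, if_neg (by omega), sub_self]
  · exact fun h => absurd (Finset.mem_univ j) h

lemma subsetWeight_Xdiag {n : ℕ} (I : Finset (Fin n)) (i : Fin n) :
    subsetWeight I (Xdiag i) = (if i ∈ I then 1 else 0) - (I.card : ℂ) / n := by
  rw [subsetWeight, LinearMap.sum_apply, Finset.sum_congr rfl fun j _ =>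
    fundamentalWeight_succ_sub j i, Finset.sum_sub_distrib, Finset.sum_ite_eq, Finset.sum_const,
    nsmul_eq_mul, mul_one_div]

/-- The coordinates of a dominant integral weight, shifted by `ρ`, are distinct and differ by
integers. -/
lemma exists_injective_int_coordinates {n : ℕ} (h0 : 0 < n) {ν : Weight n}
    (hν : IsDominantIntegral ν) :
    ∃ (c : ℂ) (A : Fin n → ℤ), Function.Injective A ∧
      ∀ i, ν (Xdiag i) + ((Finset.Ioi i).card : ℂ) = A i + c := by
  choose! a ha using hν
  refine ⟨ν (Xdiag ⟨0, h0⟩) + (n - 1), fun i => -((∑ m ∈ Finset.range i.val, (a m : ℤ)) + i.val),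
    ?_, fun i => ?_⟩
  · have hmono : StrictMono fun i : ℕ => (∑ m ∈ Finset.range i, (a m : ℤ)) + i :=
      strictMono_nat_of_lt_succ fun i => by
        rw [Finset.sum_range_succ]
        push_cast
        have : (0 : ℤ) ≤ a i := Int.natCast_nonneg _
        linarith
    intro i j h
    exact Fin.ext (hmono.injective (neg_injective h))
  · rw [weight_Xdiag ν a ha h0 i.val i.2, Fin.card_Ioi, Nat.sub_sub, Nat.cast_sub (by omega)]
    push_cast
    ring

end SLn

/-! ### From subsets of coordinates to the Prouhet–Tarry–Escott problem -/

lemma hasNontrivialPTESolution_of_finset {α : Type*} {A : α → ℤ} (hA : Function.Injective A)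
    {S T : Finset α} (hST : Disjoint S T) {m s : ℕ} (hS : S.card = m) (hT : T.card = m)
    (hm : 0 < m) (h : ∀ j ≤ s, ∑ i ∈ S, A i ^ j = ∑ i ∈ T, A i ^ j) :
    HasNontrivialPTESolution m s := by
  let e := Finset.equivFinOfCardEq hS
  let e' := Finset.equivFinOfCardEq hT
  refine ⟨fun i => A (e.symm i), fun i => A (e'.symm i), ?_, fun j _ hj => ?_⟩
  · rintro ⟨σ, hσ⟩
    have h1 := hA (congrFun hσ ⟨0, hm⟩)
    refine Finset.disjoint_left.1 hST (e.symm (σ ⟨0, hm⟩)).2 ?_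
    rw [← h1]
    exact (e'.symm ⟨0, hm⟩).2
  · rw [Equiv.sum_comp e.symm (fun i : S => A i ^ j), Equiv.sum_comp e'.symm fun i : T => A i ^ j,
      Finset.sum_coe_sort S fun i => A i ^ j, Finset.sum_coe_sort T fun i => A i ^ j]
    exact h j hj

/-- Converts power sums over all coordinates, which the Casimir elements control, into forward
differences over `S` alone. -/
lemma sum_indicator_add_pow_sub {α R : Type*} [Fintype α] [DecidableEq α] [CommRing R]
    (b : α → R) (S : Finset α) (j : ℕ) :
    ∑ i ∈ S, ((b i + 1) ^ j - b i ^ j)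
      = ∑ i, (b i + if i ∈ S then 1 else 0) ^ j - ∑ i, b i ^ j := by
  rw [← Finset.sum_sub_distrib]
  refine (Finset.sum_congr rfl fun i hi => by rw [if_pos hi]).trans
    (Finset.sum_subset (Finset.subset_univ S) fun i _ hi => ?_)
  rw [if_neg hi, add_zero, sub_self]

end

theorem proposition6p1 (n k s : ℕ) (I J : Finset (Fin n)) (hI : I.card = k) (hJ : J.card = k)
    (hIJ : I ≠ J) (ν : SLn.Weight n) (hν : SLn.IsDominantIntegral ν)
    (hνI : SLn.IsDominantIntegral (ν + SLn.subsetWeight I))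
    (hνJ : SLn.IsDominantIntegral (ν + SLn.subsetWeight J))
    (hf : ∀ p : ℕ, 2 ≤ p → p ≤ s + 1 → SLn.f k p I ν = SLn.f k p J ν) :
    HasNontrivialPTESolution (k - (I ∩ J).card) s := by
  have hcI : (I \ J).card = k - (I ∩ J).card := by
    rw [Finset.card_sdiff, Finset.inter_comm, hI]
  have hcJ : (J \ I).card = k - (I ∩ J).card := by
    rw [Finset.card_sdiff, hJ]
  have hpos : 0 < k - (I ∩ J).card := by
    rw [← hcI, Finset.card_pos, Finset.sdiff_nonempty]
    exact fun h => hIJ (Finset.eq_of_subset_of_card_le h (by rw [hI, hJ]))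
  have hn : 0 < n := by
    obtain ⟨i, -⟩ := Finset.card_pos.1 (hcI ▸ hpos)
    exact i.pos
  obtain ⟨c, A, hA, hc⟩ := SLn.exists_injective_int_coordinates hn hν
  -- The terms χ_ν and χ_{ω_k} of f are the same for I and J and cancel.
  have hsum := SLn.sum_pow_eq_of_chi_casimir_eq hνI hνJ (s + 1) fun p h2 hp =>
    sub_left_injective (sub_left_injective (hf p h2 hp))
  let b : Fin n → ℂ := fun i => A i + (c - (k : ℂ) / n)
  have hb : ∀ S : Finset (Fin n), S.card = k → ∀ i,
      (ν + SLn.subsetWeight S) (SLn.Xdiag i) + ((Finset.Ioi i).card : ℂ)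
        = b i + if i ∈ S then 1 else 0 := by
    intro S hS i
    rw [LinearMap.add_apply, SLn.subsetWeight_Xdiag, hS]
    linear_combination hc i
  simp only [hb I hI, hb J hJ] at hsum
  -- Passing from forward differences of exponent j + 1 to power sums of exponent j costs one
  -- degree: s + 1 becomes s.
  have hbpow := sum_pow_eq_of_sum_forward_difference_eq I J b b s fun j hj => by
    rw [sum_indicator_add_pow_sub, sum_indicator_add_pow_sub, hsum (j + 1) (by omega)]
  have hApow := sum_add_pow_eq_of_sum_pow_eq I J b b (-(c - (k : ℂ) / n)) s hbpow
  refine hasNontrivialPTESolution_of_finset hA disjoint_sdiff_sdiff hcI hcJ hpos fun j hj => ?_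
  have h := hApow j hj
  simp only [b, add_neg_cancel_right] at h
  have h' : ∑ i ∈ I, A i ^ j = ∑ i ∈ J, A i ^ j := by exact_mod_cast h
  -- The common part I ∩ J cancels, leaving I \ J and J \ I, each of size k - r.
  rw [← Finset.sum_inter_add_sum_sdiff I J, ← Finset.sum_inter_add_sum_sdiff J I,
    Finset.inter_comm J I] at h'
  exact add_left_cancel h'
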